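/- Let $G$ be a closed $2$-cell embedding of a finite connected graph (loops and multiple edges allowed) with at least two edges in a surface: every face is an open disk whose boundary walk is a cycle of the graph (no repeated vertex or edge). Let $D\subseteq E(G)$; call the edges in $D$ dual and the others primal. A vertex or face of $G$ is pure if its incident edges are all dual or all primal, and mixed otherwise. A corner is an incidence of a vertex and a face (an edge of the radial graph); it has two (possibly equal) consecutive edges of $G$ at its sides. A corner is $0$-pure if its two edges are both dual or both primal, while its vertex and its face are both mixed. A pure vertex is exposed if more than one of its corners has a mixed face, and a pure face is exposed if more than one of its corners has a mixed vertex. The partial dual $G^D$ is obtained from the ribbon graph of $G$ by taking the boundary components of the union of all vertex disks and the ribbons of the edges in $D$, gluing a new vertex disk onto each of them, and deleting the interiors of the old vertex disks. (In terms of graph-encoded maps: swap the colours red and blue on the red-blue $4$-cycles of the edges in $D$.) The primal/dual separation graph $S$ is the subgraph of the barycentric subdivision of $G$ formed by those edges that have, on one side, a triangle containing the midpoint of a dual edge and, on the other side, a triangle containing the midpoint of a primal edge. Its Petrie dual $S^\times$ is the embedding (in a possibly disconnected surface) of the same graph obtained by toggling all edge signatures of the rotation system with signatures that $S$ inherits;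 its faces are bounded by the Petrie walks of $S$. Suppose that $G$ has no exposed pure vertices, no exposed pure faces and no $0$-pure corners with respect to $D$. Then $G^D$ is a closed $2$-cell embedding if and only if $S^\times$ has no two distinct faces that share two or more edges. -/

import Mathlib

/-- A graph-encoded map (gem) with vertex set `X`: a properly 3-edge-coloured cubic graph in which
every red-blue bigon is a 4-cycle; `red x` is the neighbour of `x` along the red edge, and so on.
It encodes cellularly embedded graphs without isolated vertices (one for each connected component
of the gem): glue a disk onto every bigon, and the disks on red-yellow, red-blue and yellow-blue
bigons are the vertices (0-bands), edges (1-bands) and faces (2-bands).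

The elements of `X` are the flags (triangles of the barycentric subdivision): a flag belongs to one
vertex, one edge and one face. `red`, `yellow`, `blue` change, respectively, only the face, only
the edge, only the vertex. -/
structure EmbGem (X : Type*) where
  red : X → X
  yellow : X → X
  blue : X → X
  red_red : ∀ x, red (red x) = x
  yellow_yellow : ∀ x, yellow (yellow x) = x
  blue_blue : ∀ x, blue (blue x) = x
  red_ne : ∀ x, red x ≠ x
  yellow_ne : ∀ x, yellow x ≠ x
  blue_ne : ∀ x, blue x ≠ x
  red_blue : ∀ x, red (blue x) = blue (red x)
  red_ne_blue : ∀ x, red x ≠ blue x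

namespace EmbGem

/-- The equivalence relation whose classes are the bigons with colours `f` and `g`. -/
def bigonSetoid {X : Type*} (f g : X → X) : Setoid X :=
  Relation.EqvGen.setoid fun x y => y = f x ∨ y = g x

variable {X : Type*} (G : EmbGem X)

/-- The vertices of the embedded graph: red-yellow bigons. -/
def Vertex : Type _ := Quotient (bigonSetoid G.red G.yellow)

/-- The edges of the embedded graph: red-blue bigons. -/
def Edge : Type _ := Quotient (bigonSetoid G.red G.blue)

/-- The faces of the embedded graph: yellow-blue bigons. -/
def Face : Type _ := Quotient (bigonSetoid G.yellow G.blue)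

/-- The corners of the embedded graph, places where a vertex and a face meet: yellow edges of the
gem. -/
def Corner : Type _ := Quotient (bigonSetoid G.yellow G.yellow)

/-- The vertex of a flag. -/
def vertex (x : X) : G.Vertex := Quotient.mk (bigonSetoid G.red G.yellow) x

/-- The edge of a flag. -/
def edge (x : X) : G.Edge := Quotient.mk (bigonSetoid G.red G.blue) x

/-- The face of a flag. -/
def face (x : X) : G.Face := Quotient.mk (bigonSetoid G.yellow G.blue) x

/-- The corner of a flag. -/
def corner (x : X) : G.Corner := Quotient.mk (bigonSetoid G.yellow G.yellow) x

theorem vertex_yellow (x : X) : G.vertex (G.yellow x) = G.vertex x :=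
  (Quotient.sound (s := bigonSetoid G.red G.yellow)
    (Relation.EqvGen.rel _ _ (Or.inr rfl))).symm

theorem face_yellow (x : X) : G.face (G.yellow x) = G.face x :=
  (Quotient.sound (s := bigonSetoid G.yellow G.blue)
    (Relation.EqvGen.rel _ _ (Or.inl rfl))).symm

theorem edge_red (x : X) : G.edge (G.red x) = G.edge x :=
  (Quotient.sound (s := bigonSetoid G.red G.blue)
    (Relation.EqvGen.rel _ _ (Or.inl rfl))).symm

theorem edge_blue (x : X) : G.edge (G.blue x) = G.edge x :=
  (Quotient.sound (s := bigonSetoid G.red G.blue)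
    (Relation.EqvGen.rel _ _ (Or.inr rfl))).symm

theorem corner_lift_aux {α : Type*} (F : X → α) (hF : ∀ x, F (G.yellow x) = F x)
    (x y : X) (h : (bigonSetoid G.yellow G.yellow).r x y) : F x = F y := by
  induction h with
  | rel a b hab => rcases hab with rfl | rfl <;> exact (hF a).symm
  | refl a => rfl
  | symm a b _ ih => exact ih.symm
  | trans a b c _ _ ih₁ ih₂ => exact ih₁.trans ih₂

/-- The vertex at a corner. -/
def cornerVertex : G.Corner → G.Vertex :=
  Quotient.lift G.vertex (G.corner_lift_aux G.vertex G.vertex_yellow)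

/-- The face at a corner. -/
def cornerFace : G.Corner → G.Face :=
  Quotient.lift G.face (G.corner_lift_aux G.face G.face_yellow)

/-- The unordered pair of (possibly equal) edges at a corner. -/
def cornerEdges : G.Corner → Sym2 G.Edge :=
  Quotient.lift (fun x => s(G.edge x, G.edge (G.yellow x)))
    (G.corner_lift_aux _ fun x => by rw [G.yellow_yellow, Sym2.eq_swap])

/-! ### Closed 2-cell embeddings -/

/-- The gem is connected, that is, it encodes a 2-cell embedding of one connected graph in one
connected surface. -/
def IsConnected : Prop :=
  ∀ x y, Relation.EqvGen (fun a b => b = G.red a ∨ b = G.yellow a ∨ b = G.blue a) x y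

/-- One step of tracing a face: go along the edge of the flag to its other end, then turn to the
next edge of the same face. -/
def faceStep (x : X) : X := G.yellow (G.blue x)

/-- The boundary walk of the face of `x`, traced from the flag `x`, is
`v₀ e₀ v₁ e₁ … v₍ₙ₋₁₎ e₍ₙ₋₁₎ v₀`, where `vᵢ` and `eᵢ` are the vertex and the edge of the `i`-th
iterate of `faceStep` and `n` is the first time that the tracing repeats. It is a cycle in the
graph (possibly a loop or a pair of parallel edges) if no vertex and no edge is repeated. -/
def BoundaryWalkIsCycle (x : X) : Prop :=
  Set.InjOn (fun i : ℕ => G.vertex (G.faceStep^[i] x))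
      (Set.Iio (Function.minimalPeriod G.faceStep x)) ∧
    Set.InjOn (fun i : ℕ => G.edge (G.faceStep^[i] x))
      (Set.Iio (Function.minimalPeriod G.faceStep x))

/-- A closed 2-cell embedding (of a connected graph): the boundary walk of each face is a cycle
in the graph. -/
def IsClosedTwoCell : Prop :=
  G.IsConnected ∧ ∀ x, G.BoundaryWalkIsCycle x

/-! ### Partial duals and Petrie duals -/

open Classical in
/-- The partial dual with respect to `D`: red and blue are swapped on the bigons of the edges in
`D`. Thus the new vertex disks are glued along the boundary components of the union of the
vertex disks and of the ribbons of `D` (made of yellow arcs, of the blue sides of the ribbons in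
`D` and of the red ends of the ribbons not in `D`), and all ribbons are kept. -/
noncomputable def partialDual (D : Set G.Edge) : EmbGem X where
  red x := if G.edge x ∈ D then G.blue x else G.red x
  yellow := G.yellow
  blue x := if G.edge x ∈ D then G.red x else G.blue x
  red_red x := by
    by_cases h : G.edge x ∈ D <;> simp [h, G.edge_red, G.edge_blue, G.red_red, G.blue_blue]
  yellow_yellow := G.yellow_yellow
  blue_blue x := by
    by_cases h : G.edge x ∈ D <;> simp [h, G.edge_red, G.edge_blue, G.red_red, G.blue_blue]
  red_ne x := by
    by_cases h : G.edge x ∈ D <;> simp [h, G.red_ne, G.blue_ne]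
  yellow_ne := G.yellow_ne
  blue_ne x := by
    by_cases h : G.edge x ∈ D <;> simp [h, G.red_ne, G.blue_ne]
  red_blue x := by
    by_cases h : G.edge x ∈ D <;> simp [h, G.edge_red, G.edge_blue, G.red_blue]
  red_ne_blue x := by
    by_cases h : G.edge x ∈ D
    · simpa [h] using (G.red_ne_blue x).symm
    · simpa [h] using G.red_ne_blue x

/-- The Petrie dual: in every red-blue bigon, the blue edges are replaced by the diagonals. The
graph stays the same and every edge is crossed at its midpoint in tracing a face, so that the
faces are bounded by the Petrie walks. -/
def petrieDual : EmbGem X where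
  red := G.red
  yellow := G.yellow
  blue x := G.red (G.blue x)
  red_red := G.red_red
  yellow_yellow := G.yellow_yellow
  blue_blue x := by rw [G.red_blue (G.red (G.blue x)), G.red_red, G.blue_blue]
  red_ne := G.red_ne
  yellow_ne := G.yellow_ne
  blue_ne x h := G.red_ne_blue x (by rw [← h, G.red_red, h])
  red_blue x := by rw [← G.red_blue]
  red_ne_blue x h := G.blue_ne x (by rw [← G.red_red (G.blue x), ← h, G.red_red])

/-- An edge is incident with a face if some flag belongs to both. -/
def EdgeFaceIncident (e : G.Edge) (f : G.Face) : Prop :=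
  ∃ x, G.edge x = e ∧ G.face x = f

/-- There are two different faces that share two or more edges. -/
def TwoFacesShareTwoEdges : Prop :=
  ∃ f f' : G.Face, f ≠ f' ∧
    {e : G.Edge | G.EdgeFaceIncident e f ∧ G.EdgeFaceIncident e f'}.Nontrivial

/-! ### Subgraphs of an embedded graph -/

/-- The flag reached from `x` by turning at its vertex, away from the side of `x`, past `k` edges. -/
def turn (k : ℕ) (x : X) : X := G.yellow ((fun z => G.red (G.yellow z))^[k] x)

theorem turn_succ (k : ℕ) (x : X) : G.turn (k + 1) x = G.yellow (G.red (G.turn k x)) := by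
  simp only [turn, Function.iterate_succ_apply']

theorem turn_succ' (k : ℕ) (x : X) : G.turn (k + 1) x = G.turn k (G.red (G.yellow x)) := by
  simp only [turn, Function.iterate_succ_apply]

theorem turn_turn (k : ℕ) (x : X) : G.turn k (G.turn k x) = x := by
  induction k generalizing x with
  | zero => simp [turn, G.yellow_yellow]
  | succ k ih =>
    rw [G.turn_succ k x, G.turn_succ', G.yellow_yellow, G.red_red, ih]

theorem turn_ne (k : ℕ) (x : X) : G.turn k x ≠ x := by
  induction k using Nat.strong_induction_on generalizing x with
  | _ k ih =>
    match k with
    | 0 => exact G.yellow_ne x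
    | 1 =>
      intro h
      have h' : G.yellow (G.red (G.yellow x)) = x := h
      exact G.red_ne (G.yellow x) (by rw [← G.yellow_yellow (G.red (G.yellow x)), h'])
    | k + 2 =>
      intro h
      rw [G.turn_succ, G.turn_succ'] at h
      refine ih k (by omega) (G.red (G.yellow x)) ?_
      rw [← G.red_red (G.turn k _), ← G.yellow_yellow (G.red (G.turn k _)), h]

theorem turn_turn_add (j m : ℕ) (x : X) :
    G.turn j (G.turn (j + 1 + m) x) = G.red (G.turn m x) := by
  induction j with
  | zero =>
    rw [show 0 + 1 + m = m + 1 by omega, G.turn_succ]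
    simp [turn, G.yellow_yellow]
  | succ j ih =>
    rw [show j + 1 + 1 + m = (j + 1 + m) + 1 by omega, G.turn_succ (j + 1 + m), G.turn_succ',
      G.yellow_yellow, G.red_red, ih]

theorem exists_turn_mem [Finite X] (A : Set G.Edge) (x : X) (hx : G.edge x ∈ A) :
    ∃ k, G.edge (G.turn k x) ∈ A := by
  have hinj : Function.Injective fun z => G.red (G.yellow z) := fun a b h => by
    have h' : G.red (G.yellow a) = G.red (G.yellow b) := h
    rw [← G.yellow_yellow a, ← G.red_red (G.yellow a), h', G.red_red, G.yellow_yellow]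
  obtain ⟨n, hn, hp⟩ := Function.mem_periodicPts.1 (hinj.mem_periodicPts x)
  obtain ⟨k, rfl⟩ := Nat.exists_eq_succ_of_ne_zero hn.ne'
  refine ⟨k, ?_⟩
  have h : G.red (G.turn k x) = x := by
    have := hp.eq
    rwa [Function.iterate_succ_apply'] at this
  rw [← G.edge_red, h]
  exact hx

open Classical in
/-- The flag on the next edge of `A` around the vertex of `x`, turning away from the side
of `x`, and facing back to `x`. -/
noncomputable def nextIn [Finite X] (A : Set G.Edge) (x : {x : X // G.edge x ∈ A}) :
    {x : X // G.edge x ∈ A} :=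
  ⟨G.turn (Nat.find (G.exists_turn_mem A x.1 x.2)) x.1,
    Nat.find_spec (G.exists_turn_mem A x.1 x.2)⟩

open Classical in
theorem nextIn_nextIn [Finite X] (A : Set G.Edge) (x : {x : X // G.edge x ∈ A}) :
    G.nextIn A (G.nextIn A x) = x := by
  set k := Nat.find (G.exists_turn_mem A x.1 x.2) with hk
  have hkx : (G.nextIn A x).1 = G.turn k x.1 := rfl
  have key : Nat.find (G.exists_turn_mem A (G.nextIn A x).1 (G.nextIn A x).2) = k := by
    rw [Nat.find_eq_iff]
    refine ⟨by rw [hkx, G.turn_turn]; exact x.2, fun j hj hA => ?_⟩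
    rw [hkx] at hA
    obtain ⟨m, hm⟩ : ∃ m, k = j + 1 + m := ⟨k - (j + 1), by omega⟩
    rw [hm, G.turn_turn_add, G.edge_red] at hA
    exact Nat.find_min (G.exists_turn_mem A x.1 x.2) (m := m) (by omega) hA
  apply Subtype.ext
  change G.turn (Nat.find (G.exists_turn_mem A (G.nextIn A x).1 (G.nextIn A x).2))
    (G.nextIn A x).1 = x.1
  rw [key, hkx, G.turn_turn]

/-- The embedded subgraph formed by the edges in `A` and their ends, by deletion of all other
edges from the rotations around the vertices (edge signatures are kept). -/
noncomputable def subgraph [Finite X] (A : Set G.Edge) : EmbGem {x : X // G.edge x ∈ A} where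
  red x := ⟨G.red x.1, by rw [G.edge_red]; exact x.2⟩
  yellow := G.nextIn A
  blue x := ⟨G.blue x.1, by rw [G.edge_blue]; exact x.2⟩
  red_red x := Subtype.ext (G.red_red x.1)
  yellow_yellow := G.nextIn_nextIn A
  blue_blue x := Subtype.ext (G.blue_blue x.1)
  red_ne x h := G.red_ne x.1 (congrArg Subtype.val h)
  yellow_ne x h := G.turn_ne _ x.1 (congrArg Subtype.val h)
  blue_ne x h := G.blue_ne x.1 (congrArg Subtype.val h)
  red_blue x := Subtype.ext (G.red_blue x.1)
  red_ne_blue x h := G.red_ne_blue x.1 (congrArg Subtype.val h)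

/-! ### The barycentric subdivision and the separation graph -/

/-- The triangles of the barycentric subdivision are the flags `x`; the corners of a triangle are
its vertex (type 0), the midpoint of its edge (type 1) and the centre of its face (type 2).
`across j x` is the triangle on the other side of the side of `x` opposite its corner of
type `j`. -/
def across (j : Fin 3) : X → X :=
  match j with
  | 0 => G.blue
  | 1 => G.yellow
  | 2 => G.red

theorem across_across (j : Fin 3) (x : X) : G.across j (G.across j x) = x := by
  fin_cases j
  · exact G.blue_blue x
  · exact G.yellow_yellow x
  · exact G.red_red x

theorem across_ne (j : Fin 3) (x : X) : G.across j x ≠ x := by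
  fin_cases j
  · exact G.blue_ne x
  · exact G.yellow_ne x
  · exact G.red_ne x

/-- The barycentric subdivision. Its flag `(x, σ)` consists of the triangle `x`, the side of `x`
joining the corners of types `σ 0` and `σ 1`, and the end of type `σ 0` of this side. -/
def barycentric : EmbGem (X × Equiv.Perm (Fin 3)) where
  red p := (G.across (p.2 2) p.1, p.2)
  yellow p := (p.1, p.2 * Equiv.swap 1 2)
  blue p := (p.1, p.2 * Equiv.swap 0 1)
  red_red p := by simp [G.across_across]
  yellow_yellow p := by simp [mul_assoc]
  blue_blue p := by simp [mul_assoc]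
  red_ne p h := G.across_ne _ _ (congrArg Prod.fst h)
  yellow_ne p h := by
    have h' : p.2 * Equiv.swap 1 2 = p.2 := congrArg Prod.snd h
    exact absurd (mul_eq_left.1 h') (by decide)
  blue_ne p h := by
    have h' : p.2 * Equiv.swap 0 1 = p.2 := congrArg Prod.snd h
    exact absurd (mul_eq_left.1 h') (by decide)
  red_blue p := by
    have : (Equiv.swap (0 : Fin 3) 1) 2 = 2 := by decide
    simp [this]
  red_ne_blue p h := by
    have h' : p.2 = p.2 * Equiv.swap 0 1 := congrArg Prod.snd h
    exact absurd (mul_eq_left.1 h'.symm) (by decide)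

/-- The edges of the barycentric subdivision with a triangle of an edge in `D` on one side and
a triangle of an edge not in `D` on the other side. -/
def separationEdges (D : Set G.Edge) : Set G.barycentric.Edge :=
  {a | ∃ p, G.barycentric.edge p = a ∧
    G.edge p.1 ∈ D ∧ G.edge (G.barycentric.red p).1 ∉ D}

/-- The (primal/dual) separation graph of `D`, with its embedding: a subgraph of the barycentric
subdivision. -/
noncomputable def separationGraph [Finite X] (D : Set G.Edge) :
    EmbGem {p : X × Equiv.Perm (Fin 3) // G.barycentric.edge p ∈ G.separationEdges D} :=
  G.barycentric.subgraph (G.separationEdges D)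

/-! ### Pure and mixed vertices, faces and corners; `D` is the set of dual edges -/

/-- All edges incident with `v` are dual, or all of them are primal. -/
def IsPureVertex (D : Set G.Edge) (v : G.Vertex) : Prop :=
  (∀ x, G.vertex x = v → G.edge x ∈ D) ∨ (∀ x, G.vertex x = v → G.edge x ∉ D)

/-- All edges incident with `f` are dual, or all of them are primal. -/
def IsPureFace (D : Set G.Edge) (f : G.Face) : Prop :=
  (∀ x, G.face x = f → G.edge x ∈ D) ∨ (∀ x, G.face x = f → G.edge x ∉ D)

/-- Some incident edge is dual and some incident edge is primal. -/
def IsMixedVertex (D : Set G.Edge) (v : G.Vertex) : Prop :=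
  (∃ x, G.vertex x = v ∧ G.edge x ∈ D) ∧ (∃ x, G.vertex x = v ∧ G.edge x ∉ D)

/-- Some incident edge is dual and some incident edge is primal. -/
def IsMixedFace (D : Set G.Edge) (f : G.Face) : Prop :=
  (∃ x, G.face x = f ∧ G.edge x ∈ D) ∧ (∃ x, G.face x = f ∧ G.edge x ∉ D)

/-- A corner is pure if its two edges are both dual or both primal; it is 0-pure if, moreover,
none of its vertex and its face is pure. -/
def IsZeroPureCorner (D : Set G.Edge) (c : G.Corner) : Prop :=
  ((∀ e ∈ G.cornerEdges c, e ∈ D) ∨ (∀ e ∈ G.cornerEdges c, e ∉ D)) ∧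
    ¬ G.IsPureVertex D (G.cornerVertex c) ∧ ¬ G.IsPureFace D (G.cornerFace c)

/-- A pure vertex is exposed if it has more than one incidence (corner) with mixed faces. -/
def IsExposedVertex (D : Set G.Edge) (v : G.Vertex) : Prop :=
  G.IsPureVertex D v ∧
    {c : G.Corner | G.cornerVertex c = v ∧ G.IsMixedFace D (G.cornerFace c)}.Nontrivial

/-- A pure face is exposed if it has more than one incidence (corner) with mixed vertices. -/
def IsExposedFace (D : Set G.Edge) (f : G.Face) : Prop :=
  G.IsPureFace D f ∧
    {c : G.Corner | G.cornerFace c = f ∧ G.IsMixedVertex D (G.cornerVertex c)}.Nontrivial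

end EmbGem

namespace EmbGem
section

/-! A connected embedding with at least two edges is closed 2-cell exactly when no vertex and face
have two common corners (`IsClosedTwoCell.cornersInjective`, `CornersInjective.isClosedTwoCell`).
Partial duality keeps the yellow edges of the gem, so $G$ and $G^D$ have the same corners, and the
question is whether two corners can have the same vertex and the same face in $G^D$.

If one of the two corners lies between edges of the same kind, the hypotheses on exposed vertices,
exposed faces and 0-pure corners exclude this (`corner_eq_of_not_isSeparating`). The remaining
corners, between a dual and a primal edge, are the edges of $S$.

Turning around an end of such an edge in $S$, until the next edge of $S$, crosses edges of $G$ of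
one kind only; at a suitable end this follows a vertex of $G^D$, at the other end a face. At a
separating corner the kind of edge changes, so the suitable end changes together with the side: this
is a Petrie walk. Hence the faces of $S^\times$ are the vertices and faces of $G^D$ that have a
separating corner, and every edge of $S$ lies on one of each sort. Two faces of $S^\times$ with two
common edges are thus a vertex and a face of $G^D$ with two common separating corners
(`twoFacesShareTwoEdges_iff`). -/

theorem eq_of_bigonSetoid {X α : Type*} {f g : X → X} (F : X → α) (hf : ∀ x, F (f x) = F x)
    (hg : ∀ x, F (g x) = F x) {x y : X} (h : (bigonSetoid f g).r x y) : F x = F y := by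
  induction h with
  | rel a b hab => rcases hab with rfl | rfl; exacts [(hf a).symm, (hg a).symm]
  | refl a => rfl
  | symm a b _ ih => exact ih.symm
  | trans a b c _ _ ih₁ ih₂ => exact ih₁.trans ih₂

/-- A set closed under two involutions and containing a point contains its bigon. -/
theorem mem_of_bigonSetoid {X : Type*} {f g : X → X} (P : X → Prop) (hff : ∀ x, f (f x) = x)
    (hgg : ∀ x, g (g x) = x) (hf : ∀ x, P x → P (f x)) (hg : ∀ x, P x → P (g x))
    {x y : X} (h : (bigonSetoid f g).r x y) (hx : P x) : P y := by
  refine (eq_of_bigonSetoid P (fun x => propext ⟨fun h => ?_, hf x⟩)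
    (fun x => propext ⟨fun h => ?_, hg x⟩) h).mp hx
  · simpa [hff] using hf _ h
  · simpa [hgg] using hg _ h

/-! ### Functions constant on bigons, and the flags of a corner or an edge -/

variable {X : Type*} (G : EmbGem X)

theorem vertex_red (x : X) : G.vertex (G.red x) = G.vertex x :=
  (Quotient.sound (s := bigonSetoid G.red G.yellow) (Relation.EqvGen.rel _ _ (Or.inl rfl))).symm

theorem face_blue (x : X) : G.face (G.blue x) = G.face x :=
  (Quotient.sound (s := bigonSetoid G.yellow G.blue) (Relation.EqvGen.rel _ _ (Or.inr rfl))).symm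

theorem corner_yellow (x : X) : G.corner (G.yellow x) = G.corner x :=
  (Quotient.sound (s := bigonSetoid G.yellow G.yellow) (Relation.EqvGen.rel _ _ (Or.inl rfl))).symm

variable {G}

theorem apply_eq_of_vertex_eq {α : Type*} (F : X → α) (hr : ∀ x, F (G.red x) = F x)
    (hy : ∀ x, F (G.yellow x) = F x) {x y : X} (h : G.vertex x = G.vertex y) : F x = F y :=
  eq_of_bigonSetoid F hr hy (Quotient.exact h)

theorem apply_eq_of_edge_eq {α : Type*} (F : X → α) (hr : ∀ x, F (G.red x) = F x)
    (hb : ∀ x, F (G.blue x) = F x) {x y : X} (h : G.edge x = G.edge y) : F x = F y :=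
  eq_of_bigonSetoid F hr hb (Quotient.exact h)

theorem apply_eq_of_face_eq {α : Type*} (F : X → α) (hy : ∀ x, F (G.yellow x) = F x)
    (hb : ∀ x, F (G.blue x) = F x) {x y : X} (h : G.face x = G.face y) : F x = F y :=
  eq_of_bigonSetoid F hy hb (Quotient.exact h)

theorem corner_eq_iff {x y : X} : G.corner x = G.corner y ↔ y = x ∨ y = G.yellow x := by
  constructor
  · intro h
    refine mem_of_bigonSetoid (fun y => y = x ∨ y = G.yellow x) G.yellow_yellow G.yellow_yellow
      ?_ ?_ (Quotient.exact h) (Or.inl rfl) <;>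
    · rintro z (rfl | rfl)
      · exact Or.inr rfl
      · exact Or.inl (G.yellow_yellow _)
  · rintro (rfl | rfl)
    · rfl
    · exact (G.corner_yellow x).symm

theorem edge_eq_cases {x y : X} (h : G.edge x = G.edge y) :
    y = x ∨ y = G.red x ∨ y = G.blue x ∨ y = G.red (G.blue x) := by
  refine mem_of_bigonSetoid (fun y => y = x ∨ y = G.red x ∨ y = G.blue x ∨ y = G.red (G.blue x))
    G.red_red G.blue_blue ?_ ?_ (Quotient.exact h) (Or.inl rfl) <;>
  · rintro z (rfl | rfl | rfl | rfl) <;> simp [G.red_blue, G.red_red, G.blue_blue]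

/-! ### Closed 2-cell embeddings and corners -/

variable (G) in
/-- Every vertex and every face have at most one corner in common. -/
def CornersInjective : Prop :=
  ∀ x y, G.vertex x = G.vertex y → G.face x = G.face y → G.corner x = G.corner y

variable (G) in
/-- The geometric dual. -/
def dual : EmbGem X where
  red := G.blue
  yellow := G.yellow
  blue := G.red
  red_red := G.blue_blue
  yellow_yellow := G.yellow_yellow
  blue_blue := G.red_red
  red_ne := G.blue_ne
  yellow_ne := G.yellow_ne
  blue_ne := G.red_ne
  red_blue x := (G.red_blue x).symm
  red_ne_blue x := (G.red_ne_blue x).symm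

/-- Tracing a face never comes back in the opposite direction: it is turning around a vertex of the
dual, so `turn_ne` applies. -/
theorem iterate_faceStep_ne_yellow (m : ℕ) (x : X) : G.faceStep^[m] x ≠ G.yellow x := by
  intro h
  have key : ∀ m x, G.faceStep^[m] (G.yellow x) = G.dual.turn m x := by
    intro m
    induction m with
    | zero => intro x; rfl
    | succ m ih =>
      intro x
      rw [Function.iterate_succ_apply', ih, turn_succ]
      rfl
  apply G.dual.turn_ne m (G.yellow x)
  rw [← key, G.yellow_yellow, h]

theorem face_faceStep (x : X) : G.face (G.faceStep x) = G.face x := by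
  rw [faceStep, G.face_yellow, G.face_blue]

theorem face_iterate_faceStep (i : ℕ) (x : X) : G.face (G.faceStep^[i] x) = G.face x := by
  induction i with
  | zero => rfl
  | succ i ih => rw [Function.iterate_succ_apply', face_faceStep, ih]

theorem iterate_faceStep_ne_yellow_iterate (i j : ℕ) (x : X) :
    G.faceStep^[j] x ≠ G.yellow (G.faceStep^[i] x) := by
  intro h
  rcases le_total i j with hij | hij
  · obtain ⟨m, rfl⟩ := Nat.exists_eq_add_of_le' hij
    rw [Function.iterate_add_apply] at h
    exact iterate_faceStep_ne_yellow m _ h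
  · obtain ⟨m, rfl⟩ := Nat.exists_eq_add_of_le' hij
    rw [Function.iterate_add_apply] at h
    exact iterate_faceStep_ne_yellow m (G.faceStep^[j] x) (by
      rw [← G.yellow_yellow (G.faceStep^[m] _), ← h])

theorem faceStep_injective : Function.Injective G.faceStep := fun a b h => by
  have h' := congrArg G.yellow h
  simp only [faceStep, G.yellow_yellow] at h'
  simpa [G.blue_blue] using congrArg G.blue h'

variable [Finite X]

theorem minimalPeriod_faceStep_pos (x : X) : 0 < Function.minimalPeriod G.faceStep x :=
  Function.minimalPeriod_pos_of_mem_periodicPts (faceStep_injective.mem_periodicPts x)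

theorem exists_iterate_faceStep {x y : X} (h : G.face x = G.face y) :
    ∃ i < Function.minimalPeriod G.faceStep x,
      y = G.faceStep^[i] x ∨ y = G.yellow (G.faceStep^[i] x) := by
  suffices h' : ∃ i, y = G.faceStep^[i] x ∨ y = G.yellow (G.faceStep^[i] x) by
    obtain ⟨i, hi⟩ := h'
    refine ⟨i % Function.minimalPeriod G.faceStep x,
      Nat.mod_lt _ (minimalPeriod_faceStep_pos x), ?_⟩
    rwa [Function.iterate_mod_minimalPeriod_eq]
  refine mem_of_bigonSetoid (fun y => ∃ i, y = G.faceStep^[i] x ∨ y = G.yellow (G.faceStep^[i] x))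
    G.yellow_yellow G.blue_blue ?_ ?_ (Quotient.exact h) ⟨0, Or.inl rfl⟩
  · rintro z ⟨i, rfl | rfl⟩
    · exact ⟨i, Or.inr rfl⟩
    · exact ⟨i, Or.inl (G.yellow_yellow _)⟩
  · rintro z ⟨i, rfl | rfl⟩
    · refine ⟨i + 1, Or.inr ?_⟩
      rw [Function.iterate_succ_apply', faceStep, G.yellow_yellow]
    -- Here `blue` undoes one step of the tracing. As `n + 1` is the period, this amounts to `n`
    -- further steps.
    · obtain ⟨n, hn⟩ := Nat.exists_eq_succ_of_ne_zero (minimalPeriod_faceStep_pos (G := G) x).ne'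
      refine ⟨i + n, Or.inl (faceStep_injective (G := G) ?_)⟩
      rw [← Function.iterate_succ_apply' G.faceStep, ← Nat.add_succ, ← hn,
        Function.iterate_add_apply, Function.iterate_minimalPeriod, faceStep, G.blue_blue,
        G.yellow_yellow]

/-- A second common corner would be a second visit of the boundary walk to the vertex. -/
theorem IsClosedTwoCell.cornersInjective (h : G.IsClosedTwoCell) : G.CornersInjective := by
  intro x y hv hf
  obtain ⟨i, hi, hy⟩ := exists_iterate_faceStep hf
  have h0 : i = 0 := (h.2 x).1 hi (minimalPeriod_faceStep_pos x) (by
    rcases hy with rfl | rfl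
    · exact hv.symm
    · rw [G.vertex_yellow] at hv
      exact hv.symm)
  subst h0
  exact corner_eq_iff.2 hy

omit [Finite X] in
-- If one face lies on both sides of an edge, then at each end the corners on the two sides
-- coincide. Both ends then have degree one and the edge is the whole connected graph.
theorem CornersInjective.face_red_ne (h : G.CornersInjective) (hG : G.IsConnected)
    (hedges : ∃ x y, G.edge x ≠ G.edge y) (z : X) : G.face (G.red z) ≠ G.face z := by
  intro hz
  have key : ∀ w, G.face (G.red w) = G.face w → G.yellow w = G.red w := fun w hw => by
    rcases corner_eq_iff.1 (h w (G.red w) (G.vertex_red w).symm hw.symm) with h' | h'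
    · exact absurd h' (G.red_ne w)
    · exact h'.symm
  have h1 := key z hz
  have h2 := key (G.blue z) (by rw [G.red_blue, G.face_blue, G.face_blue, hz])
  have hy : ∀ w, G.edge w = G.edge z → G.edge (G.yellow w) = G.edge z := by
    intro w hw
    rcases edge_eq_cases hw.symm with rfl | rfl | rfl | rfl
    · rw [h1, G.edge_red]
    · rw [← h1, G.yellow_yellow]
    · rw [h2, G.edge_red, G.edge_blue]
    · rw [← h2, G.yellow_yellow, G.edge_blue]
  have hy' : ∀ w, G.edge (G.yellow w) = G.edge z ↔ G.edge w = G.edge z := fun w =>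
    ⟨fun hw => by simpa [G.yellow_yellow] using hy _ hw, hy w⟩
  have hall : ∀ w, G.edge z = G.edge w := by
    intro w
    have gen : ∀ a b, Relation.EqvGen
        (fun a b => b = G.red a ∨ b = G.yellow a ∨ b = G.blue a) a b →
        ((G.edge a = G.edge z) = (G.edge b = G.edge z)) := by
      intro a b hab
      induction hab with
      | rel a b hab =>
        rcases hab with rfl | rfl | rfl
        · rw [G.edge_red]
        · exact propext (hy' a).symm
        · rw [G.edge_blue]
      | refl a => rfl
      | symm a b _ ih => exact ih.symm
      | trans a b c _ _ ih₁ ih₂ => exact ih₁.trans ih₂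
    exact ((gen _ _ (hG z w)).mp rfl).symm
  obtain ⟨x, y, hxy⟩ := hedges
  exact hxy ((hall x).symm.trans (hall y))

omit [Finite X] in
-- A vertex repeated on a boundary walk gives a second common corner. A repeated edge has the face
-- on both sides or is traversed backwards on the same side; `face_red_ne` and the fixed direction
-- of tracing exclude these.
theorem CornersInjective.isClosedTwoCell (h : G.CornersInjective) (hG : G.IsConnected)
    (hedges : ∃ x y, G.edge x ≠ G.edge y) : G.IsClosedTwoCell := by
  have hred := h.face_red_ne hG hedges
  refine ⟨hG, fun x => ⟨fun i hi j hj hij => ?_, fun i hi j hj hij => ?_⟩⟩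
  · have hij : G.vertex (G.faceStep^[i] x) = G.vertex (G.faceStep^[j] x) := hij
    rcases corner_eq_iff.1 (h _ _ hij (by simp only [face_iterate_faceStep])) with h' | h'
    · exact (Function.iterate_injOn_Iio_minimalPeriod hj hi h').symm
    · exact absurd h' (iterate_faceStep_ne_yellow_iterate i j x)
  · have hij : G.edge (G.faceStep^[i] x) = G.edge (G.faceStep^[j] x) := hij
    have hf : G.face (G.faceStep^[i] x) = G.face (G.faceStep^[j] x) := by
      simp only [face_iterate_faceStep]
    rcases edge_eq_cases hij with h' | h' | h' | h'
    · exact (Function.iterate_injOn_Iio_minimalPeriod hj hi h').symm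
    · exact absurd (h' ▸ hf.symm) (hred _)
    · refine (iterate_faceStep_ne_yellow_iterate (G := G) (i + 1) j x ?_).elim
      rw [h', Function.iterate_succ_apply', faceStep, G.yellow_yellow]
    · rw [h', G.red_blue, G.face_blue] at hf
      exact absurd hf.symm (hred _)

end

section
variable {X : Type*} {G : EmbGem X} {D : Set G.Edge}

/-! ### The partial dual -/

theorem partialDual_red_of_mem {x : X} (h : G.edge x ∈ D) :
    (G.partialDual D).red x = G.blue x := by simp [partialDual, h]

theorem partialDual_red_of_notMem {x : X} (h : G.edge x ∉ D) :
    (G.partialDual D).red x = G.red x := by simp [partialDual, h]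

theorem partialDual_blue_of_mem {x : X} (h : G.edge x ∈ D) :
    (G.partialDual D).blue x = G.red x := by simp [partialDual, h]

theorem partialDual_blue_of_notMem {x : X} (h : G.edge x ∉ D) :
    (G.partialDual D).blue x = G.blue x := by simp [partialDual, h]

theorem partialDual_yellow (x : X) : (G.partialDual D).yellow x = G.yellow x := rfl

/-- Complementing `D` turns the partial dual into its geometric dual. This symmetry halves the later
arguments: a claim about vertices for `Dᶜ` is one about faces for `D`. -/
theorem partialDual_compl_red : (G.partialDual Dᶜ).red = (G.partialDual D).blue := by
  funext x
  by_cases h : G.edge x ∈ D <;> simp [partialDual, h]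

theorem edge_partialDual_red (x : X) : G.edge ((G.partialDual D).red x) = G.edge x := by
  by_cases h : G.edge x ∈ D
  · rw [partialDual_red_of_mem h, G.edge_blue]
  · rw [partialDual_red_of_notMem h, G.edge_red]

theorem edge_partialDual_blue (x : X) : G.edge ((G.partialDual D).blue x) = G.edge x := by
  by_cases h : G.edge x ∈ D
  · rw [partialDual_blue_of_mem h, G.edge_red]
  · rw [partialDual_blue_of_notMem h, G.edge_blue]

theorem edge_eq_of_partialDual_edge_eq {x y : X}
    (h : (G.partialDual D).edge x = (G.partialDual D).edge y) : G.edge x = G.edge y :=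
  apply_eq_of_edge_eq G.edge edge_partialDual_red edge_partialDual_blue h

theorem partialDual_corner_eq_iff {x y : X} :
    (G.partialDual D).corner x = (G.partialDual D).corner y ↔ G.corner x = G.corner y :=
  Iff.rfl

theorem partialDual_compl_vertex_eq_iff {x y : X} :
    (G.partialDual Dᶜ).vertex x = (G.partialDual Dᶜ).vertex y ↔
      (G.partialDual D).face x = (G.partialDual D).face y := by
  constructor
  · refine apply_eq_of_vertex_eq (G := G.partialDual Dᶜ) (G.partialDual D).face (fun x => ?_)
      (G.partialDual D).face_yellow
    rw [partialDual_compl_red, face_blue]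
  · refine apply_eq_of_face_eq (G := G.partialDual D) (G.partialDual Dᶜ).vertex
      (G.partialDual Dᶜ).vertex_yellow (fun x => ?_)
    rw [← partialDual_compl_red, vertex_red]

theorem partialDual_compl_face_eq_iff {x y : X} :
    (G.partialDual Dᶜ).face x = (G.partialDual Dᶜ).face y ↔
      (G.partialDual D).vertex x = (G.partialDual D).vertex y := by
  rw [← partialDual_compl_vertex_eq_iff (D := Dᶜ), compl_compl]

theorem IsConnected.partialDual (h : G.IsConnected) (D : Set G.Edge) :
    (G.partialDual D).IsConnected := by
  intro x y
  have := h x y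
  induction this with
  | rel a b hab =>
    by_cases hD : G.edge a ∈ D
    · apply Relation.EqvGen.rel
      rw [partialDual_red_of_mem hD, partialDual_blue_of_mem hD, partialDual_yellow]
      tauto
    · apply Relation.EqvGen.rel
      rw [partialDual_red_of_notMem hD, partialDual_blue_of_notMem hD, partialDual_yellow]
      exact hab
  | refl a => exact .refl a
  | symm a b _ ih => exact .symm _ _ ih
  | trans a b c _ _ ih₁ ih₂ => exact .trans _ _ _ ih₁ ih₂

/-- A face all of whose edges are dual is a vertex of the partial dual. -/
theorem face_eq_of_partialDual_vertex_eq {x y : X}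
    (hx : ∀ z, G.face z = G.face x → G.edge z ∈ D)
    (h : (G.partialDual D).vertex x = (G.partialDual D).vertex y) : G.face y = G.face x := by
  refine mem_of_bigonSetoid (fun y => G.face y = G.face x) (G.partialDual D).red_red
    (G.partialDual D).yellow_yellow (fun z hz => ?_) (fun z hz => ?_) (Quotient.exact h) rfl
  · rw [partialDual_red_of_mem (hx z hz), G.face_blue, hz]
  · rw [partialDual_yellow, G.face_yellow, hz]

/-- A vertex all of whose edges are dual is a face of the partial dual. -/
theorem vertex_eq_of_partialDual_face_eq {x y : X}
    (hx : ∀ z, G.vertex z = G.vertex x → G.edge z ∈ D)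
    (h : (G.partialDual D).face x = (G.partialDual D).face y) : G.vertex y = G.vertex x := by
  refine mem_of_bigonSetoid (fun y => G.vertex y = G.vertex x) (G.partialDual D).yellow_yellow
    (G.partialDual D).blue_blue (fun z hz => ?_) (fun z hz => ?_) (Quotient.exact h) rfl
  · rw [partialDual_yellow, G.vertex_yellow, hz]
  · rw [partialDual_blue_of_mem (hx z hz), G.vertex_red, hz]

/-! ### Pure corners -/

theorem isMixedVertex_iff {v : G.Vertex} : G.IsMixedVertex D v ↔ ¬ G.IsPureVertex D v := by
  unfold IsMixedVertex IsPureVertex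
  push Not
  exact and_comm

theorem isMixedFace_iff {f : G.Face} : G.IsMixedFace D f ↔ ¬ G.IsPureFace D f := by
  unfold IsMixedFace IsPureFace
  push Not
  exact and_comm

theorem isPureVertex_compl {v : G.Vertex} : G.IsPureVertex Dᶜ v ↔ G.IsPureVertex D v := by
  simp [IsPureVertex, or_comm]

theorem isPureFace_compl {f : G.Face} : G.IsPureFace Dᶜ f ↔ G.IsPureFace D f := by
  simp [IsPureFace, or_comm]

theorem isExposedVertex_compl {v : G.Vertex} :
    G.IsExposedVertex Dᶜ v ↔ G.IsExposedVertex D v := by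
  simp [IsExposedVertex, isPureVertex_compl, isMixedFace_iff, isPureFace_compl]

theorem isExposedFace_compl {f : G.Face} : G.IsExposedFace Dᶜ f ↔ G.IsExposedFace D f := by
  simp [IsExposedFace, isPureFace_compl, isMixedVertex_iff, isPureVertex_compl]

theorem isZeroPureCorner_compl {c : G.Corner} :
    G.IsZeroPureCorner Dᶜ c ↔ G.IsZeroPureCorner D c := by
  simp [IsZeroPureCorner, isPureVertex_compl, isPureFace_compl, or_comm]

theorem IsPureVertex.mem {x : X} (h : G.IsPureVertex D (G.vertex x)) (hx : G.edge x ∈ D) (z : X)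
    (hz : G.vertex z = G.vertex x) : G.edge z ∈ D := by
  rcases h with h | h
  · exact h z hz
  · exact absurd hx (h x rfl)

theorem IsPureFace.mem {x : X} (h : G.IsPureFace D (G.face x)) (hx : G.edge x ∈ D) (z : X)
    (hz : G.face z = G.face x) : G.edge z ∈ D := by
  rcases h with h | h
  · exact h z hz
  · exact absurd hx (h x rfl)

/-- A vertex and a face of the partial dual that meet at a corner between dual edges have no other
corner in common. -/
theorem corner_eq_of_mem (hG : G.CornersInjective)
    (hvertex : ∀ v : G.Vertex, ¬ G.IsExposedVertex D v)
    (hface : ∀ f : G.Face, ¬ G.IsExposedFace D f)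
    (hcorner : ∀ c : G.Corner, ¬ G.IsZeroPureCorner D c)
    {x y : X} (hx : G.edge x ∈ D) (hx' : G.edge (G.yellow x) ∈ D)
    (hv : (G.partialDual D).vertex x = (G.partialDual D).vertex y)
    (hf : (G.partialDual D).face x = (G.partialDual D).face y) : G.corner x = G.corner y := by
  by_contra hne
  by_cases pv : G.IsPureVertex D (G.vertex x) <;> by_cases pf : G.IsPureFace D (G.face x)
  · exact hne (hG x y (vertex_eq_of_partialDual_face_eq (pv.mem hx) hf).symm
      (face_eq_of_partialDual_vertex_eq (pf.mem hx) hv).symm)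
  -- The all-dual vertex of `x` is a face of the partial dual, so `y` lies at it too. If the face of
  -- `y` were pure, it would be a vertex of the partial dual and contain `x`. So both faces are
  -- mixed and the vertex is exposed.
  · have hvy := vertex_eq_of_partialDual_face_eq (pv.mem hx) hf
    have pfy : G.IsPureFace D (G.face y) := by
      by_contra pfy
      exact hvertex (G.vertex x) ⟨pv, G.corner x, ⟨rfl, isMixedFace_iff.2 pf⟩, G.corner y,
        ⟨hvy, isMixedFace_iff.2 pfy⟩, hne⟩
    have := face_eq_of_partialDual_vertex_eq (pfy.mem (pv.mem hx y hvy)) hv.symm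
    exact pf (this ▸ pfy)
  · have hfy := face_eq_of_partialDual_vertex_eq (pf.mem hx) hv
    have pvy : G.IsPureVertex D (G.vertex y) := by
      by_contra pvy
      exact hface (G.face x) ⟨pf, G.corner x, ⟨rfl, isMixedVertex_iff.2 pv⟩, G.corner y,
        ⟨hfy, isMixedVertex_iff.2 pvy⟩, hne⟩
    have := vertex_eq_of_partialDual_face_eq (pvy.mem (pf.mem hx y hfy)) hf.symm
    exact pv (this ▸ pvy)
  · refine hcorner (G.corner x) ⟨Or.inl fun e he => ?_, pv, pf⟩
    rcases Sym2.mem_iff.1 (show e ∈ s(G.edge x, G.edge (G.yellow x)) from he) with rfl | rfl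
    exacts [hx, hx']

variable (D) in
/-- The corner of `x` has a dual and a primal side. -/
def IsSeparating (x : X) : Prop := G.edge x ∈ D ↔ G.edge (G.yellow x) ∉ D

theorem isSeparating_yellow {x : X} : IsSeparating D (G.yellow x) ↔ IsSeparating D x := by
  unfold IsSeparating
  rw [G.yellow_yellow]
  tauto

theorem corner_eq_of_not_isSeparating (hG : G.CornersInjective)
    (hvertex : ∀ v : G.Vertex, ¬ G.IsExposedVertex D v)
    (hface : ∀ f : G.Face, ¬ G.IsExposedFace D f)
    (hcorner : ∀ c : G.Corner, ¬ G.IsZeroPureCorner D c)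
    {x y : X} (hx : ¬ IsSeparating D x)
    (hv : (G.partialDual D).vertex x = (G.partialDual D).vertex y)
    (hf : (G.partialDual D).face x = (G.partialDual D).face y) : G.corner x = G.corner y := by
  unfold IsSeparating at hx
  by_cases h : G.edge x ∈ D
  · exact corner_eq_of_mem hG hvertex hface hcorner h (by tauto) hv hf
  · exact corner_eq_of_mem (D := Dᶜ) hG (by simpa only [isExposedVertex_compl] using hvertex)
      (by simpa only [isExposedFace_compl] using hface)
      (by simpa only [isZeroPureCorner_compl] using hcorner) h
      (show _ ∉ _ by tauto) (partialDual_compl_vertex_eq_iff.2 hf)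
      (partialDual_compl_face_eq_iff.2 hv)

end

/-! ### Orbits that return to a set of flags -/

section
variable {X : Type*} {G : EmbGem X} {D E : Set G.Edge}

/-- If the orbits of `y` and `r` return to `M` along alternating paths, then a function on `M` that
is constant along these paths and along `y` is constant on the trace on `M` of every orbit. -/
theorem eq_of_bigonSetoid_of_return {X α : Type*} {r y : X → X} (hr : ∀ x, r (r x) = x)
    (hy : ∀ x, y (y x) = x) {M : X → Prop} (hM : ∀ x, M (y x) ↔ M x) (F : {x // M x} → α)
    (hFy : ∀ w, F ⟨y w.1, (hM w.1).2 w.2⟩ = F w)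
    (hFr : ∀ w : {x // M x}, ∃ n, ∃ h : M ((fun z => r (y z))^[n] (r w.1)),
      F ⟨_, h⟩ = F w ∧ ∀ j < n, ¬ M ((fun z => r (y z))^[j] (r w.1)))
    {w z : {x // M x}} (h : (bigonSetoid r y).r w.1 z.1) : F z = F w := by
  set u : X → ℕ → X := fun w n => (fun z => r (y z))^[n] (r w) with hu
  have hu1 : ∀ w n, u w (n + 1) = r (y (u w n)) := fun w n => Function.iterate_succ_apply' _ _ _
  -- Invariant: the point lies on a return path `r w', r (y (r w')), …` that starts at some `w'` in
  -- `M` with the right value and is followed only up to its first return to `M`.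
  have key := mem_of_bigonSetoid (fun z => ∃ w' : {x // M x}, F w' = F w ∧ ∃ n,
      (∃ h : M (u w' n), F ⟨_, h⟩ = F w ∧ ∀ j < n, ¬ M (u w' j)) ∧
      ∃ k ≤ n, z = u w' k ∨ z = r (u w' k)) hr hy ?_ ?_ h ?_
  · obtain ⟨w', hw', n, ⟨hn, hFn, hmin⟩, k, hk, hz⟩ := key
    rcases hz with hz | hz
    · have hkn : k = n := by
        by_contra hne
        exact hmin k (by omega) (hz ▸ z.2)
      subst hkn
      rw [← hFn]
      exact congrArg F (Subtype.ext hz)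
    · rcases k with _ | k
      · rw [← hw']
        refine congrArg F (Subtype.ext ?_)
        rw [hz]
        exact hr w'.1
      · rw [hu1, hr] at hz
        exact absurd ((hM _).1 (hz ▸ z.2)) (hmin k (by omega))
  · rintro x ⟨w', hw', n, hn, k, hk, rfl | rfl⟩
    · exact ⟨w', hw', n, hn, k, hk, Or.inr rfl⟩
    · exact ⟨w', hw', n, hn, k, hk, Or.inl (hr _)⟩
  -- On reaching a point of `M`, applying `y` stays in `M` and opens a new return path.
  · have start : ∀ w' : {x // M x}, F w' = F w → ∃ w'' : {x // M x}, F w'' = F w ∧ ∃ n,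
        (∃ h : M (u w'' n), F ⟨_, h⟩ = F w ∧ ∀ j < n, ¬ M (u w'' j)) ∧
        ∃ k ≤ n, y w'.1 = u w'' k ∨ y w'.1 = r (u w'' k) := by
      intro w' hw'
      obtain ⟨n, h, hF, hmin⟩ := hFr ⟨y w'.1, (hM w'.1).2 w'.2⟩
      have hF' := (hFy w').trans hw'
      exact ⟨⟨y w'.1, (hM w'.1).2 w'.2⟩, hF', n, ⟨h, hF.trans hF', hmin⟩, 0, Nat.zero_le n,
        Or.inr (hr _).symm⟩
    rintro x ⟨w', hw', n, ⟨hn, hFn, hmin⟩, k, hk, rfl | rfl⟩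
    · rcases hk.lt_or_eq with hk | rfl
      · exact ⟨w', hw', n, ⟨hn, hFn, hmin⟩, k + 1, hk, Or.inr (by rw [hu1, hr])⟩
      · exact start ⟨_, hn⟩ hFn
    · rcases k with _ | k
      · have : r (u w'.1 0) = w'.1 := hr _
        rw [this]
        exact start w' hw'
      · exact ⟨w', hw', n, ⟨hn, hFn, hmin⟩, k, by omega, Or.inl (by rw [hu1, hr, hy])⟩
  · obtain ⟨n, h, hF, hmin⟩ := hFr w
    exact ⟨w, rfl, n, ⟨h, hF, hmin⟩, 0, Nat.zero_le n, Or.inr (hr _).symm⟩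

theorem nextIn_spec [Finite X] (A : Set G.Edge) (x : {x : X // G.edge x ∈ A}) :
    ∃ k, (G.nextIn A x).1 = G.turn k x.1 ∧ ∀ j < k, G.edge (G.turn j x.1) ∉ A := by
  classical
  exact ⟨_, rfl, fun j hj => Nat.find_min (G.exists_turn_mem A x.1 x.2) hj⟩

/-! ### The flags of the separation graph -/

/-- Flags of the barycentric subdivision at vertices of the map, on sides of triangles opposite
the midpoints of edges. -/
def permVertex : Equiv.Perm (Fin 3) := Equiv.swap 1 2

/-- Flags of the barycentric subdivision at centres of faces, on sides of triangles opposite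
the midpoints of edges. -/
def permFace : Equiv.Perm (Fin 3) := Equiv.swap 1 2 * Equiv.swap 0 1

theorem eq_permVertex_or_permFace {σ : Equiv.Perm (Fin 3)} (h : σ 2 = 1) :
    σ = permVertex ∨ σ = permFace := by
  revert σ
  decide

/-- Crossing a side opposite a vertex or a face centre keeps the edge of `G`. So only the sides
opposite edge midpoints can separate, and these are the corners. -/
theorem edge_barycentric_mem_iff {p : X × Equiv.Perm (Fin 3)} :
    G.barycentric.edge p ∈ G.separationEdges D ↔ p.2 2 = 1 ∧ IsSeparating D p.1 := by
  let P : X × Equiv.Perm (Fin 3) → Prop := fun p =>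
    (G.edge p.1 ∈ D ↔ G.edge (G.barycentric.red p).1 ∉ D)
  have hP : ∀ p q, G.barycentric.edge p = G.barycentric.edge q → P p = P q := by
    intro p q
    refine apply_eq_of_edge_eq P (fun p => propext ?_) (fun p => propext ?_)
    · simp only [P, G.barycentric.red_red]
      tauto
    · simp only [P, G.barycentric.red_blue]
      rfl
  have hP' : P p ↔ p.2 2 = 1 ∧ IsSeparating D p.1 := by
    obtain ⟨x, σ⟩ := p
    change (G.edge x ∈ D ↔ G.edge (G.across (σ 2) x) ∉ D) ↔ σ 2 = 1 ∧ _
    generalize σ 2 = i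
    fin_cases i
    · simp [across, G.edge_blue]
    · simp [across, IsSeparating]
    · simp [across, G.edge_red]
  rw [← hP']
  constructor
  · rintro ⟨q, hq, h1, h2⟩
    exact (hP q p hq).mp (show _ ↔ _ by tauto)
  · intro h
    by_cases hp : G.edge p.1 ∈ D
    · exact ⟨p, rfl, hp, h.1 hp⟩
    · exact ⟨G.barycentric.red p, G.barycentric.edge_red p, by
        by_contra h'; exact hp (h.2 h'), by rw [G.barycentric.red_red]; exact hp⟩

variable (D) in
/-- The flags of the separation graph. -/
abbrev SepFlag : Type _ :=
  {p : X × Equiv.Perm (Fin 3) // G.barycentric.edge p ∈ G.separationEdges D}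

theorem SepFlag.isSeparating (p : SepFlag D) : IsSeparating D p.1.1 :=
  (edge_barycentric_mem_iff.1 p.2).2

theorem SepFlag.perm_cases (p : SepFlag D) : p.1.2 = permVertex ∨ p.1.2 = permFace :=
  eq_permVertex_or_permFace (edge_barycentric_mem_iff.1 p.2).1

open Classical in
variable (E) in
/-- The end of the side of `x` such that turning there, away from the corner, starts like
`(G.partialDual E).red`. -/
noncomputable def sidePerm (x : X) : Equiv.Perm (Fin 3) :=
  if G.edge x ∈ E then permFace else permVertex

theorem sidePerm_compl_ne (x : X) : sidePerm Eᶜ x ≠ sidePerm E x := by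
  by_cases h : G.edge x ∈ E <;> simp [sidePerm, h] <;> decide

theorem SepFlag.sidePerm_cases (E : Set G.Edge) (p : SepFlag D) :
    p.1.2 = sidePerm E p.1.1 ∨ p.1.2 = sidePerm Eᶜ p.1.1 := by
  have := p.perm_cases
  by_cases h : G.edge p.1.1 ∈ E <;> simp [sidePerm, h] <;> tauto

theorem sidePerm_two (x : X) : sidePerm E x 2 = 1 := by
  by_cases h : G.edge x ∈ E <;> simp only [sidePerm, h, if_true, if_false] <;> decide

variable (E) in
/-- The flag of the separation graph at the corner and on the side of `x` that lies on the face of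
the Petrie dual which follows the vertex of `x` in the partial dual of `E`. -/
noncomputable def sepFlag {x : X} (h : IsSeparating D x) : SepFlag D :=
  ⟨(x, sidePerm E x), edge_barycentric_mem_iff.2 ⟨sidePerm_two x, h⟩⟩

theorem eq_sepFlag {p : SepFlag D} (h : p.1.2 = sidePerm E p.1.1) :
    p = sepFlag E p.isSeparating := Subtype.ext (Prod.ext rfl h)

theorem isSeparating_of_eq_or_compl (hE : E = D ∨ E = Dᶜ) {x : X} :
    IsSeparating E x ↔ IsSeparating D x := by
  rcases hE with rfl | rfl
  · rfl
  · simp only [IsSeparating, Set.mem_compl_iff]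
    tauto

/-- The two sides of a separating corner have edges of different kinds, so the preferred end flips.
This flip is what calls for the Petrie dual. -/
theorem sidePerm_yellow {x : X} (h : IsSeparating E x) :
    sidePerm E (G.yellow x) = sidePerm E x * Equiv.swap 0 1 := by
  have h' : G.edge x ∈ E ↔ G.edge (G.yellow x) ∉ E := h
  by_cases hx : G.edge x ∈ E
  · have := h'.1 hx
    simp only [sidePerm, hx, this, if_true, if_false]
    decide
  · have : G.edge (G.yellow x) ∈ E := by tauto
    simp only [sidePerm, hx, this, if_true, if_false]
    decide

/-! ### From Petrie walks to vertices of the partial dual -/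

/-- Around either end, sides opposite edge midpoints alternate with sides through them. An odd
number of turns therefore gives a side of the former type, reached by alternating `across (sidePerm
E x 1)` and `yellow`. -/
theorem barycentric_turn (x : X) (j : ℕ) :
    G.barycentric.turn (2 * j) (x, sidePerm E x) = ((G.barycentric.turn (2 * j)
      (x, sidePerm E x)).1, sidePerm E x * Equiv.swap 1 2) ∧
    G.barycentric.turn (2 * j + 1) (x, sidePerm E x) =
      ((fun z => G.across (sidePerm E x 1) (G.yellow z))^[j] (G.across (sidePerm E x 1) x),
        sidePerm E x) := by
  have h2 := sidePerm_two (E := E) x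
  generalize sidePerm E x = σ at *
  have hswap : (Equiv.swap (1 : Fin 3) 2) 2 = 1 := by decide
  have hred : ∀ z, G.barycentric.red (z, σ) = (G.yellow z, σ) := fun z => by
    simp only [barycentric, h2]; rfl
  have hred' : ∀ z, G.barycentric.red (z, σ * Equiv.swap 1 2) =
      (G.across (σ 1) z, σ * Equiv.swap 1 2) := fun z => by
    simp only [barycentric, Equiv.Perm.mul_apply, hswap]
  have hyel : ∀ z, G.barycentric.yellow (z, σ) = (z, σ * Equiv.swap 1 2) := fun z => rfl
  have hyel' : ∀ z, G.barycentric.yellow (z, σ * Equiv.swap 1 2) = (z, σ) := fun z => by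
    simp [barycentric, mul_assoc]
  induction j with
  | zero =>
    refine ⟨rfl, ?_⟩
    change G.barycentric.turn (0 + 1) _ = _
    rw [turn_succ]
    change G.barycentric.yellow (G.barycentric.red (G.barycentric.yellow (x, σ))) = _
    rw [hyel, hred', hyel']
    rfl
  | succ j ih =>
    have h1 : G.barycentric.turn (2 * (j + 1)) (x, σ) = (G.yellow
        ((fun z => G.across (σ 1) (G.yellow z))^[j] (G.across (σ 1) x)), σ * Equiv.swap 1 2) := by
      rw [show 2 * (j + 1) = (2 * j + 1) + 1 by ring, turn_succ, ih.2, hred, hyel]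
    refine ⟨by rw [h1], ?_⟩
    rw [turn_succ, h1, hred', hyel', Function.iterate_succ_apply']

theorem across_sidePerm {x z : X} (h : G.edge z ∈ E ↔ G.edge x ∈ E) :
    G.across (sidePerm E x 1) z = (G.partialDual E).red z := by
  by_cases hx : G.edge x ∈ E
  · rw [partialDual_red_of_mem (h.2 hx)]
    simp only [sidePerm, hx, if_true]
    rfl
  · rw [partialDual_red_of_notMem (mt h.1 hx)]
    simp only [sidePerm, hx, if_false]
    rfl

variable [Finite X]

theorem exists_yellow_sepFlag (hE : E = D ∨ E = Dᶜ) {w : X} (hw : IsSeparating D w) :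
    ∃ n, ∃ h : IsSeparating D
        ((fun z => (G.partialDual E).red (G.yellow z))^[n] ((G.partialDual E).red w)),
      (G.separationGraph D).yellow (sepFlag E hw) = sepFlag E h ∧
      ∀ j < n, ¬ IsSeparating D
        ((fun z => (G.partialDual E).red (G.yellow z))^[j] ((G.partialDual E).red w)) := by
  obtain ⟨k, hk, hmin⟩ := nextIn_spec (G.separationEdges D) (sepFlag E hw)
  have hmem : G.barycentric.edge (G.barycentric.turn k (w, sidePerm E w)) ∈ G.separationEdges D :=
    hk ▸ (G.barycentric.nextIn _ (sepFlag E hw)).2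
  change ∀ j < k, G.barycentric.edge (G.barycentric.turn j (w, sidePerm E w)) ∉ _ at hmin
  obtain ⟨n, rfl | rfl⟩ := Nat.even_or_odd' k
  -- After an even number of turns the side contains an edge midpoint, so it is not in the
  -- separation graph.
  · rw [edge_barycentric_mem_iff, (barycentric_turn w n).1] at hmem
    have h1 := hmem.1
    by_cases hx : G.edge w ∈ E <;> simp only [sidePerm, hx, if_true, if_false] at h1 <;>
      exact absurd h1 (by decide)
  -- Before the first separating corner all edges passed are of the kind of `w`, so the fixed colour
  -- crossed is always the red of the partial dual.
  have hu : ∀ j ≤ n, (G.edge ((fun z => G.across (sidePerm E w 1) (G.yellow z))^[j]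
        (G.across (sidePerm E w 1) w)) ∈ E ↔ G.edge w ∈ E) ∧
      (fun z => G.across (sidePerm E w 1) (G.yellow z))^[j] (G.across (sidePerm E w 1) w) =
      (fun z => (G.partialDual E).red (G.yellow z))^[j] ((G.partialDual E).red w) := by
    intro j
    induction j with
    | zero =>
      intro _
      have h0 : G.across (sidePerm E w 1) w = (G.partialDual E).red w := across_sidePerm Iff.rfl
      refine ⟨?_, h0⟩
      rw [Function.iterate_zero_apply, h0, edge_partialDual_red]
    | succ j ih =>
      intro hj
      obtain ⟨ih1, ih2⟩ := ih (by omega)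
      have hns := hmin (2 * j + 1) (by omega)
      rw [edge_barycentric_mem_iff, (barycentric_turn w j).2, ← isSeparating_of_eq_or_compl hE]
        at hns
      simp only [Function.iterate_succ_apply']
      rw [← ih2]
      generalize (fun z => G.across (sidePerm E w 1) (G.yellow z))^[j]
        (G.across (sidePerm E w 1) w) = t at *
      have ht : G.edge (G.yellow t) ∈ E ↔ G.edge w ∈ E := by
        have : ¬ (G.edge t ∈ E ↔ G.edge (G.yellow t) ∉ E) := fun h => hns ⟨sidePerm_two w, h⟩
        tauto
      rw [across_sidePerm ht, edge_partialDual_red]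
      exact ⟨ht, rfl⟩
  obtain ⟨hs, hn⟩ := hu n le_rfl
  have hS : IsSeparating D
      ((fun z => (G.partialDual E).red (G.yellow z))^[n] ((G.partialDual E).red w)) := by
    rw [← hn]
    rw [(barycentric_turn w n).2, edge_barycentric_mem_iff] at hmem
    exact hmem.2
  refine ⟨n, hS, Subtype.ext (hk.trans ?_), fun j hj h => ?_⟩
  · refine (barycentric_turn w n).2.trans ?_
    rw [hn] at hs ⊢
    refine Prod.ext rfl ?_
    change sidePerm E w = sidePerm E _
    by_cases hx : G.edge w ∈ E
    · simp only [sidePerm, hs.2 hx, hx, if_true]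
    · simp only [sidePerm, mt hs.1 hx, hx, if_false]
  · apply hmin (2 * j + 1) (by omega)
    rw [(barycentric_turn w j).2, edge_barycentric_mem_iff, (hu j (by omega)).2]
    exact ⟨sidePerm_two w, h⟩

/-- The twisted blue step changes both the end and the side of the corner, and by `sidePerm_yellow`
this is again the preferred end. -/
theorem blue_sepFlag (hE : E = D ∨ E = Dᶜ) {w : X} (hw : IsSeparating D w) :
    (G.separationGraph D).petrieDual.blue (sepFlag E hw) =
      sepFlag E (isSeparating_yellow.2 hw) := by
  refine Subtype.ext (Prod.ext ?_ ?_)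
  · change G.across ((sidePerm E w * Equiv.swap 0 1 : Equiv.Perm (Fin 3)) 2) w = G.yellow w
    rw [Equiv.Perm.mul_apply, show (Equiv.swap (0 : Fin 3) 1) 2 = 2 by decide, sidePerm_two]
    rfl
  · exact (sidePerm_yellow ((isSeparating_of_eq_or_compl hE).2 hw)).symm

/-- Flags of the separation graph following the same vertex of the partial dual lie on the same
face of the Petrie dual. -/
theorem petrieDual_face_eq (hE : E = D ∨ E = Dᶜ) {w z : X} (hw : IsSeparating D w)
    (hz : IsSeparating D z) (h : (G.partialDual E).vertex w = (G.partialDual E).vertex z) :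
    (G.separationGraph D).petrieDual.face (sepFlag E hw) =
      (G.separationGraph D).petrieDual.face (sepFlag E hz) := by
  refine (eq_of_bigonSetoid_of_return (M := IsSeparating D) (w := ⟨w, hw⟩) (z := ⟨z, hz⟩) (G.partialDual E).red_red
    (G.partialDual E).yellow_yellow
    (fun _ => isSeparating_yellow) (fun w => (G.separationGraph D).petrieDual.face
      (sepFlag E w.2)) (fun w => ?_) (fun w => ?_) (Quotient.exact h)).symm
  · rw [← face_blue _ (sepFlag E w.2), blue_sepFlag hE]
    rfl
  · obtain ⟨n, hn, h1, h2⟩ := exists_yellow_sepFlag hE w.2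
    refine ⟨n, hn, ?_, h2⟩
    rw [← face_yellow _ (sepFlag E w.2)]
    exact congrArg (G.separationGraph D).petrieDual.face h1.symm

/-! ### Faces of the Petrie dual as vertices and faces of the partial dual -/

open Classical in
/-- The vertex or the face of the partial dual followed by the face of the Petrie dual of the
separation graph at a flag. -/
noncomputable def petrieLabel (p : SepFlag D) :
    (G.partialDual D).Vertex ⊕ (G.partialDual D).Face :=
  if p.1.2 = sidePerm D p.1.1 then Sum.inl ((G.partialDual D).vertex p.1.1)
  else Sum.inr ((G.partialDual D).face p.1.1)

omit [Finite X] in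
theorem petrieLabel_sepFlag {w : X} (hw : IsSeparating D w) :
    petrieLabel (sepFlag D hw) = Sum.inl ((G.partialDual D).vertex w) := if_pos rfl

omit [Finite X] in
theorem petrieLabel_sepFlag_compl {w : X} (hw : IsSeparating D w) :
    petrieLabel (sepFlag Dᶜ hw) = Sum.inr ((G.partialDual D).face w) :=
  if_neg (sidePerm_compl_ne w)

omit [Finite X] in
theorem vertex_iterate_red_yellow {H : EmbGem X} (n : ℕ) (w : X) :
    H.vertex ((fun z => H.red (H.yellow z))^[n] (H.red w)) = H.vertex w := by
  induction n with
  | zero => exact H.vertex_red w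
  | succ n ih => rw [Function.iterate_succ_apply', vertex_red, vertex_yellow, ih]

omit [Finite X] in
theorem vertex_eq_of_petrieLabel_eq {p q : SepFlag D} (hp : p.1.2 = sidePerm D p.1.1)
    (h : petrieLabel p = petrieLabel q) :
    (G.partialDual D).vertex p.1.1 = (G.partialDual D).vertex q.1.1 := by
  rw [eq_sepFlag hp, petrieLabel_sepFlag] at h
  rcases q.sidePerm_cases D with hq | hq
  · rw [eq_sepFlag hq, petrieLabel_sepFlag] at h
    exact Sum.inl.inj h
  · rw [eq_sepFlag hq, petrieLabel_sepFlag_compl] at h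
    exact absurd h Sum.inl_ne_inr

omit [Finite X] in
theorem face_eq_of_petrieLabel_eq {p q : SepFlag D} (hp : p.1.2 = sidePerm Dᶜ p.1.1)
    (h : petrieLabel p = petrieLabel q) :
    (G.partialDual D).face p.1.1 = (G.partialDual D).face q.1.1 := by
  rw [eq_sepFlag hp, petrieLabel_sepFlag_compl] at h
  rcases q.sidePerm_cases D with hq | hq
  · rw [eq_sepFlag hq, petrieLabel_sepFlag] at h
    exact absurd h.symm Sum.inl_ne_inr
  · rw [eq_sepFlag hq, petrieLabel_sepFlag_compl] at h
    exact Sum.inr.inj h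

/-- Both steps along a Petrie walk keep the sort of a flag (preferred end for `D` or for `Dᶜ`) and
stay on the vertex or face that it follows. -/
theorem petrieLabel_eq_of_face_eq {p q : SepFlag D}
    (h : (G.separationGraph D).petrieDual.face p = (G.separationGraph D).petrieDual.face q) :
    petrieLabel p = petrieLabel q := by
  refine apply_eq_of_face_eq petrieLabel (fun p => ?_) (fun p => ?_) h
  · rcases p.sidePerm_cases D with hp | hp
    · rw [eq_sepFlag hp]
      obtain ⟨n, hn, h1, -⟩ := exists_yellow_sepFlag (Or.inl rfl) p.isSeparating
      refine (congrArg petrieLabel h1).trans ?_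
      rw [petrieLabel_sepFlag, petrieLabel_sepFlag]
      exact congrArg Sum.inl (vertex_iterate_red_yellow (H := G.partialDual D) n _)
    · rw [eq_sepFlag hp]
      obtain ⟨n, hn, h1, -⟩ := exists_yellow_sepFlag (E := Dᶜ) (Or.inr rfl) p.isSeparating
      refine (congrArg petrieLabel h1).trans ?_
      rw [petrieLabel_sepFlag_compl, petrieLabel_sepFlag_compl]
      exact congrArg Sum.inr (partialDual_compl_vertex_eq_iff.1
        (vertex_iterate_red_yellow (H := G.partialDual Dᶜ) n _))
  · rcases p.sidePerm_cases D with hp | hp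
    · rw [eq_sepFlag hp, blue_sepFlag (Or.inl rfl), petrieLabel_sepFlag, petrieLabel_sepFlag]
      exact congrArg Sum.inl ((G.partialDual D).vertex_yellow _)
    · rw [eq_sepFlag hp, blue_sepFlag (Or.inr rfl), petrieLabel_sepFlag_compl,
        petrieLabel_sepFlag_compl]
      exact congrArg Sum.inr ((G.partialDual D).face_yellow _)

/-- The four flags of an edge of the separation graph are the two sides of one corner, each with its
two ends. -/
theorem petrieDual_edge_eq_iff {p q : SepFlag D} :
    (G.separationGraph D).petrieDual.edge p = (G.separationGraph D).petrieDual.edge q ↔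
      G.corner p.1.1 = G.corner q.1.1 := by
  have hred : ∀ p : SepFlag D, ((G.separationGraph D).petrieDual.red p).1 =
      (G.yellow p.1.1, p.1.2) := fun p => by
    change (G.across (p.1.2 2) p.1.1, p.1.2) = _
    rw [(edge_barycentric_mem_iff.1 p.2).1]
    rfl
  have hblue : ∀ p : SepFlag D, ((G.separationGraph D).petrieDual.blue p).1 =
      (G.yellow p.1.1, p.1.2 * Equiv.swap 0 1) := fun p => by
    have := (edge_barycentric_mem_iff.1 ((G.separationGraph D).blue p).2).1
    change (G.across ((p.1.2 * Equiv.swap 0 1 : Equiv.Perm (Fin 3)) 2) p.1.1, _) = _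
    rw [show (p.1.2 * Equiv.swap 0 1 : Equiv.Perm (Fin 3)) 2 = 1 from this]
    rfl
  constructor
  · refine apply_eq_of_edge_eq (fun p : SepFlag D => G.corner p.1.1) (fun p => ?_) (fun p => ?_)
    · rw [hred, corner_yellow]
    · rw [hblue, corner_yellow]
  · intro h
    have key : ∀ p q : SepFlag D, p.1.1 = q.1.1 →
        (G.separationGraph D).petrieDual.edge p = (G.separationGraph D).petrieDual.edge q := by
      intro p q h
      have hpq : p = q ∨ p = (G.separationGraph D).petrieDual.red
          ((G.separationGraph D).petrieDual.blue q) := by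
        have h2 : p.1.2 = q.1.2 ∨ p.1.2 = q.1.2 * Equiv.swap 0 1 := by
          rcases p.perm_cases with h1 | h1 <;> rcases q.perm_cases with h2 | h2 <;>
            rw [h1, h2] <;> decide
        refine h2.imp (fun h2 => Subtype.ext (Prod.ext h h2)) fun h2 => Subtype.ext ?_
        rw [hred, hblue, G.yellow_yellow]
        exact Prod.ext h h2
      rcases hpq with rfl | rfl
      · rfl
      · rw [edge_red, edge_blue]
    rcases corner_eq_iff.1 h with h | h
    · exact key p q h.symm
    · rw [← edge_red _ p]
      exact key _ q (by rw [hred, h])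

theorem twoFacesShareTwoEdges_iff :
    (G.separationGraph D).petrieDual.TwoFacesShareTwoEdges ↔
      ∃ x y, IsSeparating D x ∧ IsSeparating D y ∧
        (G.partialDual D).vertex x = (G.partialDual D).vertex y ∧
        (G.partialDual D).face x = (G.partialDual D).face y ∧ G.corner x ≠ G.corner y := by
  constructor
  · rintro ⟨f, f', hne, e, ⟨⟨p, hp, hpf⟩, ⟨p', hp', hpf'⟩⟩, e', ⟨⟨q, hq, hqf⟩, ⟨q', hq', hqf'⟩⟩,
      hee⟩
    change SepFlag D at p p' q q'
    have hc := petrieDual_edge_eq_iff.1 (hp.trans hp'.symm)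
    have hc' := petrieDual_edge_eq_iff.1 (hq.trans hq'.symm)
    have hl := petrieLabel_eq_of_face_eq (hpf.trans hqf.symm)
    have hl' := petrieLabel_eq_of_face_eq (hpf'.trans hqf'.symm)
    have hcc : G.corner p.1.1 ≠ G.corner q.1.1 := fun h =>
      hee (hp.symm.trans ((petrieDual_edge_eq_iff.2 h).trans hq))
    have hv : ∀ {x y : X}, G.corner x = G.corner y →
        (G.partialDual D).vertex x = (G.partialDual D).vertex y := fun h =>
      congrArg (G.partialDual D).cornerVertex (partialDual_corner_eq_iff.2 h)
    have hf : ∀ {x y : X}, G.corner x = G.corner y →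
        (G.partialDual D).face x = (G.partialDual D).face y := fun h =>
      congrArg (G.partialDual D).cornerFace (partialDual_corner_eq_iff.2 h)
    -- At one corner, flags of the same sort lie on the same face of the Petrie dual. As `f ≠ f'`,
    -- one of them follows a vertex and the other a face of the partial dual.
    have same : ∀ E, E = D ∨ E = Dᶜ → p.1.2 = sidePerm E p.1.1 → p'.1.2 ≠ sidePerm E p'.1.1 := by
      intro E hE h h'
      refine hne (hpf.symm.trans (Eq.trans ?_ hpf'))
      rw [eq_sepFlag h, eq_sepFlag h']
      refine petrieDual_face_eq hE _ _ ?_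
      rcases hE with rfl | rfl
      · exact hv hc
      · exact partialDual_compl_vertex_eq_iff.2 (hf hc)
    refine ⟨p.1.1, q.1.1, p.isSeparating, q.isSeparating, ?_, ?_, hcc⟩
    · rcases p.sidePerm_cases D with h | h
      · exact vertex_eq_of_petrieLabel_eq h hl
      · exact (hv hc).trans ((vertex_eq_of_petrieLabel_eq
          ((p'.sidePerm_cases D).resolve_right (same _ (Or.inr rfl) h)) hl').trans (hv hc').symm)
    · rcases p.sidePerm_cases D with h | h
      · exact (hf hc).trans ((face_eq_of_petrieLabel_eq
          ((p'.sidePerm_cases D).resolve_left (same _ (Or.inl rfl) h)) hl').trans (hf hc').symm)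
      · exact face_eq_of_petrieLabel_eq h hl
  · rintro ⟨x, y, hx, hy, hv, hf, hne⟩
    -- The two faces are those through the flags of both sorts at `x`; their labels lie in different
    -- summands, so they differ.
    refine ⟨_, _, fun h => ?_, _, ⟨⟨sepFlag D hx, rfl, rfl⟩, ⟨sepFlag Dᶜ hx, ?_, rfl⟩⟩,
      (G.separationGraph D).petrieDual.edge (sepFlag D hy),
      ⟨⟨sepFlag D hy, rfl, (petrieDual_face_eq (Or.inl rfl) hx hy hv).symm⟩,
        ⟨sepFlag Dᶜ hy, petrieDual_edge_eq_iff.2 rfl, (petrieDual_face_eq (Or.inr rfl) hx hy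
          (partialDual_compl_vertex_eq_iff.2 hf)).symm⟩⟩, fun h => ?_⟩
    · have := petrieLabel_eq_of_face_eq h
      rw [petrieLabel_sepFlag, petrieLabel_sepFlag_compl] at this
      exact Sum.inl_ne_inr this
    · exact petrieDual_edge_eq_iff.2 rfl
    · exact hne (petrieDual_edge_eq_iff.1 h)

end

theorem exists_edge_ne {X : Type*} {G : EmbGem X} (h : 2 ≤ Nat.card G.Edge) :
    ∃ x y, G.edge x ≠ G.edge y := by
  have : Finite G.Edge := Nat.finite_of_card_ne_zero (by omega)
  have : Nontrivial G.Edge := Finite.one_lt_card_iff_nontrivial.1 h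
  obtain ⟨a, b, hab⟩ := exists_pair_ne G.Edge
  obtain ⟨x, rfl⟩ := Quotient.exists_rep a
  obtain ⟨y, rfl⟩ := Quotient.exists_rep b
  exact ⟨x, y, hab⟩

end EmbGem

theorem mainTheorem5 {X : Type*} [Finite X] (G : EmbGem X) (hG : G.IsClosedTwoCell)
    (hedges : 2 ≤ Nat.card G.Edge) (D : Set G.Edge)
    (hvertex : ∀ v : G.Vertex, ¬ G.IsExposedVertex D v)
    (hface : ∀ f : G.Face, ¬ G.IsExposedFace D f)
    (hcorner : ∀ c : G.Corner, ¬ G.IsZeroPureCorner D c) :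
    (G.partialDual D).IsClosedTwoCell ↔
      ¬ (G.separationGraph D).petrieDual.TwoFacesShareTwoEdges := by
  rw [EmbGem.twoFacesShareTwoEdges_iff]
  constructor
  · rintro h ⟨x, y, -, -, hv, hf, hne⟩
    exact hne (EmbGem.partialDual_corner_eq_iff.1 (h.cornersInjective x y hv hf))
  · intro h
    have hci : (G.partialDual D).CornersInjective := by
      intro x y hv hf
      rw [EmbGem.partialDual_corner_eq_iff]
      by_contra hne
      -- One non-separating corner suffices for a contradiction; two separating ones are excluded by
      -- the assumption on the Petrie dual.
      by_cases hx : EmbGem.IsSeparating D x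
      · by_cases hy : EmbGem.IsSeparating D y
        · exact h ⟨x, y, hx, hy, hv, hf, hne⟩
        · exact hne (EmbGem.corner_eq_of_not_isSeparating hG.cornersInjective hvertex hface hcorner
            hy hv.symm hf.symm).symm
      · exact hne (EmbGem.corner_eq_of_not_isSeparating hG.cornersInjective hvertex hface hcorner
          hx hv hf)
    obtain ⟨x, y, hxy⟩ := EmbGem.exists_edge_ne hedges
    exact hci.isClosedTwoCell (hG.1.partialDual D)
      ⟨x, y, fun h => hxy (EmbGem.edge_eq_of_partialDual_edge_eq h)⟩
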